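/- Let $-\infty<a<b<\infty$, $\Omega=(a,b)$ and $0<\alpha<1$. For $\sigma>0$ let $${}^-I^{\sigma}f(x)=\frac1{\Gamma(\sigma)}\int_a^x\frac{f(y)}{(x-y)^{1-\sigma}}\,dy,\qquad {}^+I^{\sigma}f(x)=\frac1{\Gamma(\sigma)}\int_x^b\frac{f(y)}{(y-x)^{1-\sigma}}\,dy$$ be the left and right Riemann–Liouville fractional integrals, and let ${}^-D^{\alpha}f=\frac{d}{dx}\,{}^-I^{1-\alpha}f$ and ${}^+D^{\alpha}f=-\frac{d}{dx}\,{}^+I^{1-\alpha}f$ be the left and right Riemann–Liouville derivatives. For $u\in L^1(\Omega)$, a function $v\in L^1_{loc}(\Omega)$ is called the left (respectively right) weak fractional derivative of $u$ of order $\alpha$, written $v={}^-\mathcal D^{\alpha}u$ (respectively $v={}^+\mathcal D^{\alpha}u$), if $$\int_\Omega v\,\varphi\,dx=\int_\Omega u\;{}^{+}D^{\alpha}\tilde\varphi\,dx\qquad\Big(\text{respectively }\int_\Omega v\,\varphi\,dx=\int_\Omega u\;{}^{-}D^{\alpha}\tilde\varphi\,dx\Big)\qquad\text{for all }\varphi\in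 C_0^\infty(\Omega),$$ where $\tilde\varphi$ is the extension of $\varphi$ by zero. Let $\kappa^{\alpha}_-(x)=(x-a)^{\alpha-1}$ and $\kappa^{\alpha}_+(x)=(b-x)^{\alpha-1}$. **Theorem (Fundamental Theorem of Weak Fractional Calculus, finite interval).** Let $1\le p<\infty$ and let $u\in L^p(\Omega)$ be real-valued. (i) If the left weak fractional derivative ${}^-\mathcal D^{\alpha}u$ exists and belongs to $L^p(\Omega)$, then ${}^-I^{1-\alpha}u$ agrees almost everywhere in $\Omega$ with an absolutely continuous function on $[a,b]$, whose value at $a$ is denoted by ${}^-I^{1-\alpha}u(a)$, and $$u=c_-^{1-\alpha}\,\kappa^{\alpha}_-+{}^-I^{\alpha}\,{}^-\mathcal D^{\alpha}u\quad\text{a.e. in }\Omega,\qquad c_-^{1-\alpha}=\frac{{}^-I^{1-\alpha}u(a)}{\Gamma(\alpha)}.$$ (ii) If the right weak fractional derivative ${}^+\mathcal D^{\alpha}u$ exists and belongs to $L^p(\Omega)$, then ${}^+I^{1-\alpha}u$ agrees almost everywhere in $\Omega$ with an absolutely continuous function on $[a,b]$, whose value at $b$ is denoted by ${}^+I^{1-\alpha}u(b)$,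 and $$u=c_+^{1-\alpha}\,\kappa^{\alpha}_++{}^+I^{\alpha}\,{}^+\mathcal D^{\alpha}u\quad\text{a.e. in }\Omega,\qquad c_+^{1-\alpha}=\frac{{}^+I^{1-\alpha}u(b)}{\Gamma(\alpha)}.$$ -/

import Mathlib

open MeasureTheory Set

/-- Left Riemann–Liouville fractional integral of order `σ > 0` on the interval starting at `a`:
`(1/Γ(σ)) ∫_a^x f(y) / (x - y)^(1-σ) dy`. -/
noncomputable def leftFracIntegral (a σ : ℝ) (f : ℝ → ℝ) (x : ℝ) : ℝ :=
  1 / Real.Gamma σ * ∫ y in a..x, f y / (x - y) ^ (1 - σ)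

/-- Right Riemann–Liouville fractional integral of order `σ > 0` on the interval ending at `b`:
`(1/Γ(σ)) ∫_x^b f(y) / (y - x)^(1-σ) dy`. -/
noncomputable def rightFracIntegral (b σ : ℝ) (f : ℝ → ℝ) (x : ℝ) : ℝ :=
  1 / Real.Gamma σ * ∫ y in x..b, f y / (y - x) ^ (1 - σ)

/-- Left Riemann–Liouville fractional derivative of order `0 < α < 1`. -/
noncomputable def leftFracDeriv (a α : ℝ) (f : ℝ → ℝ) (x : ℝ) : ℝ :=
  deriv (leftFracIntegral a (1 - α) f) x

/-- Right Riemann–Liouville fractional derivative of order `0 < α < 1`. -/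
noncomputable def rightFracDeriv (b α : ℝ) (f : ℝ → ℝ) (x : ℝ) : ℝ :=
  -deriv (rightFracIntegral b (1 - α) f) x

/-- The zero extension to `ℝ` of a smooth function with compact support in the open
interval `(a, b)`. -/
structure IsTestFun (a b : ℝ) (φ : ℝ → ℝ) : Prop where
  smooth : ContDiff ℝ (⊤ : ℕ∞) φ
  compact : HasCompactSupport φ
  supp : tsupport φ ⊆ Ioo a b

/-- `v` is the left weak fractional derivative of `u` of order `0 < α < 1` on `(a, b)`;
the sign `(-1)^⌊α⌋` is `1`. As `φ` vanishes outside `(a, b)`, its right Riemann–Liouville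
derivative based at `b` agrees on `(a, b)` with the one taken on the whole line. -/
structure IsLeftWeakFracDeriv (a b α : ℝ) (u v : ℝ → ℝ) : Prop where
  integrable : IntegrableOn u (Ioo a b)
  locallyIntegrable : LocallyIntegrableOn v (Ioo a b)
  integral_eq : ∀ φ : ℝ → ℝ, IsTestFun a b φ →
    ∫ x in Ioo a b, v x * φ x = ∫ x in Ioo a b, u x * rightFracDeriv b α φ x

/-- `w` is the right weak fractional derivative of `u` of order `0 < α < 1` on `(a, b)`. -/
structure IsRightWeakFracDeriv (a b α : ℝ) (u w : ℝ → ℝ) : Prop where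
  integrable : IntegrableOn u (Ioo a b)
  locallyIntegrable : LocallyIntegrableOn w (Ioo a b)
  integral_eq : ∀ φ : ℝ → ℝ, IsTestFun a b φ →
    ∫ x in Ioo a b, w x * φ x = ∫ x in Ioo a b, u x * leftFracDeriv a α φ x

/-- `F` is the (unique on `[a, b]`) absolutely continuous representative on `[a, b]` of the
almost everywhere class of `g` on `(a, b)`; the values `g(a)` and `g(b)` of the class are `F a`
and `F b`. -/
structure IsACRepresentative (a b : ℝ) (g F : ℝ → ℝ) : Prop where
  absolutelyContinuous : AbsolutelyContinuousOnInterval F a b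
  ae_eq : ∀ᵐ x ∂(volume.restrict (Ioo a b)), F x = g x

/-- The kernel function `(x - a)^(α - 1)`. -/
noncomputable def leftKernel (a α x : ℝ) : ℝ := (x - a) ^ (α - 1)

/-- The kernel function `(b - x)^(α - 1)`. -/
noncomputable def rightKernel (b α x : ℝ) : ℝ := (b - x) ^ (α - 1)

/-! Put `G` for the left integral of `u` of order `1 - α`. On a test function `φ` the right
derivative is minus the right integral of `φ'`, so Fubini turns the definition of `v` into `∫ v φ =
-∫ G φ'`: `v` is the ordinary distributional derivative of `G`. Du Bois-Reymond then gives `G = c +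
∫_a^x v` a.e., which is the absolutely continuous representative, with value `c` at `a`.

It remains to invert the integral of order `1 - α`. By the Beta integral it sends the kernel to the
constant `Γ(α)` and the order-`α` integral of `v` to `∫_a^x v`. Hence it annihilates `u - c/Γ(α) κ -
I^α v`; applying `I^α` shows that the primitive of this difference vanishes, so the difference is
zero a.e. (`ae_eq_of_leftFracIntegral_ae_eq`).

The right-hand case follows by the reflection `x ↦ a + b - x`. The exponent `p` enters only through
`L^p ⊆ L^1` on a bounded interval. -/

/-- The Riemann–Liouville kernel `t ^ (σ - 1)`, cut off to `(0, L)`. -/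
noncomputable def rlKernel (L σ : ℝ) : ℝ → ℝ := (Ioo 0 L).indicator fun t => t ^ (σ - 1)

/-! ### Fractional integrals as convolutions of integrable functions -/

theorem rlKernel_of_mem {L t : ℝ} (σ : ℝ) (ht : t ∈ Ioo 0 L) : rlKernel L σ t = t ^ (σ - 1) :=
  indicator_of_mem ht _

theorem rlKernel_of_nonpos {t : ℝ} (L σ : ℝ) (ht : t ≤ 0) : rlKernel L σ t = 0 :=
  indicator_of_notMem (fun h => absurd h.1 ht.not_gt) _

theorem rlKernel_nonneg (L σ t : ℝ) : 0 ≤ rlKernel L σ t :=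
  indicator_nonneg (fun _ hx => Real.rpow_nonneg hx.1.le _) t

theorem integrable_rlKernel (L : ℝ) {σ : ℝ} (hσ : 0 < σ) : Integrable (rlKernel L σ) := by
  rw [rlKernel, integrable_indicator_iff measurableSet_Ioo]
  rcases le_or_gt L 0 with hL | hL
  · simp [Ioo_eq_empty_of_le hL]
  · exact ((intervalIntegrable_iff_integrableOn_Ioo_of_le hL.le).1
      (intervalIntegral.intervalIntegrable_rpow' (by linarith)))

theorem measurable_rlKernel (L σ : ℝ) : Measurable (rlKernel L σ) :=
  (measurable_id.pow_const _).indicator measurableSet_Ioo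

theorem div_rpow_one_sub {t : ℝ} (ht : 0 < t) (c σ : ℝ) : c / t ^ (1 - σ) = c * t ^ (σ - 1) := by
  rw [div_eq_mul_inv, ← Real.rpow_neg ht.le, neg_sub]

/-- Since `0 < x - y < b - a` whenever `a < y < x < b`, the cut-off at `b - a` loses nothing, while
the vanishing of the kernel for `t ≤ 0` encodes `y < x`. -/
theorem indicator_mul_rlKernel {a b x : ℝ} (hx : x ∈ Ioo a b) (σ : ℝ) (f : ℝ → ℝ) :
    (fun y => (Ioo a b).indicator f y * rlKernel (b - a) σ (x - y)) =
      (Ioo a x).indicator fun y => f y / (x - y) ^ (1 - σ) := by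
  funext y
  by_cases hy : y ∈ Ioo a x
  · rw [indicator_of_mem hy, indicator_of_mem (show y ∈ Ioo a b from ⟨hy.1, hy.2.trans hx.2⟩),
      rlKernel_of_mem σ ⟨sub_pos.2 hy.2, by linarith [hy.1, hx.2]⟩,
      div_rpow_one_sub (sub_pos.2 hy.2)]
  · rw [indicator_of_notMem hy]
    by_cases hya : a < y
    · rw [rlKernel_of_nonpos _ _ (sub_nonpos.2 (not_lt.1 fun h => hy ⟨hya, h⟩)), mul_zero]
    · rw [indicator_of_notMem (fun h => hya h.1), zero_mul]

theorem indicator_mul_rlKernel_right {a b x : ℝ} (hx : x ∈ Ioo a b) (σ : ℝ) (f : ℝ → ℝ) :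
    (fun y => (Ioo a b).indicator f y * rlKernel (b - a) σ (y - x)) =
      (Ioo x b).indicator fun y => f y / (y - x) ^ (1 - σ) := by
  funext y
  by_cases hy : y ∈ Ioo x b
  · rw [indicator_of_mem hy, indicator_of_mem (show y ∈ Ioo a b from ⟨hx.1.trans hy.1, hy.2⟩),
      rlKernel_of_mem σ ⟨sub_pos.2 hy.1, by linarith [hy.2, hx.1]⟩,
      div_rpow_one_sub (sub_pos.2 hy.1)]
  · rw [indicator_of_notMem hy]
    by_cases hyb : y < b
    · rw [rlKernel_of_nonpos _ _ (sub_nonpos.2 (not_lt.1 fun h => hy ⟨h, hyb⟩)), mul_zero]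
    · rw [indicator_of_notMem (fun h => hyb h.2), zero_mul]

theorem leftFracIntegral_eq_integral_rlKernel {a b x : ℝ} (hx : x ∈ Ioo a b) (σ : ℝ)
    (f : ℝ → ℝ) :
    leftFracIntegral a σ f x = 1 / Real.Gamma σ *
      ∫ y, (Ioo a b).indicator f y * rlKernel (b - a) σ (x - y) := by
  rw [indicator_mul_rlKernel hx, integral_indicator measurableSet_Ioo, leftFracIntegral,
    intervalIntegral.integral_of_le hx.1.le, integral_Ioc_eq_integral_Ioo]

theorem rightFracIntegral_eq_integral_rlKernel {a b x : ℝ} (hx : x ∈ Ioo a b) (σ : ℝ)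
    (f : ℝ → ℝ) :
    rightFracIntegral b σ f x = 1 / Real.Gamma σ *
      ∫ y, (Ioo a b).indicator f y * rlKernel (b - a) σ (y - x) := by
  rw [indicator_mul_rlKernel_right hx, integral_indicator measurableSet_Ioo, rightFracIntegral,
    intervalIntegral.integral_of_le hx.2.le, integral_Ioc_eq_integral_Ioo]

theorem integrable_indicator_mul_rlKernel {a b σ : ℝ} (hσ : 0 < σ) {f : ℝ → ℝ}
    (hf : IntegrableOn f (Ioo a b)) :
    Integrable (fun q : ℝ × ℝ => (Ioo a b).indicator f q.2 * rlKernel (b - a) σ (q.1 - q.2))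
      (volume.prod volume) := by
  simpa using (hf.integrable_indicator measurableSet_Ioo).convolution_integrand
    (ContinuousLinearMap.mul ℝ ℝ) (integrable_rlKernel (b - a) hσ)

theorem integrableOn_leftFracIntegral {a b σ : ℝ} (hσ : 0 < σ) {f : ℝ → ℝ}
    (hf : IntegrableOn f (Ioo a b)) : IntegrableOn (leftFracIntegral a σ f) (Ioo a b) :=
  (((integrable_indicator_mul_rlKernel hσ hf).integral_prod_left.const_mul
    (1 / Real.Gamma σ)).integrableOn).congr_fun
      (fun _ hx => (leftFracIntegral_eq_integral_rlKernel hx σ f).symm) measurableSet_Ioo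

/-- Fubini gives integrable sections for almost every `x` only. This is what licenses splitting the
fractional integral of a difference. -/
theorem ae_intervalIntegrable_leftFracIntegral {a b σ : ℝ} (hσ : 0 < σ) {f : ℝ → ℝ}
    (hf : IntegrableOn f (Ioo a b)) :
    ∀ᵐ x ∂(volume.restrict (Ioo a b)),
      IntervalIntegrable (fun y => f y / (x - y) ^ (1 - σ)) volume a x := by
  rw [ae_restrict_iff' measurableSet_Ioo]
  filter_upwards [(integrable_indicator_mul_rlKernel hσ hf).prod_right_ae] with x hx hxab
  rw [indicator_mul_rlKernel hxab, integrable_indicator_iff measurableSet_Ioo] at hx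
  exact (intervalIntegrable_iff_integrableOn_Ioo_of_le hxab.1.le).2 hx

theorem leftFracIntegral_congr_ae {a b x : ℝ} (hx : x ∈ Ioo a b) (σ : ℝ) {f g : ℝ → ℝ}
    (h : f =ᵐ[volume.restrict (Ioo a b)] g) :
    leftFracIntegral a σ f x = leftFracIntegral a σ g x := by
  rw [leftFracIntegral_eq_integral_rlKernel hx, leftFracIntegral_eq_integral_rlKernel hx]
  congr 1
  refine integral_congr_ae ?_
  filter_upwards [(ae_restrict_iff' measurableSet_Ioo).1 h] with y hy
  by_cases hym : y ∈ Ioo a b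
  · simp only [indicator_of_mem hym, hy hym]
  · simp only [indicator_of_notMem hym]

/-! ### The Beta integral and composition of complementary orders -/

/-- The Beta exponents `1 - σ` and `σ` sum to `1`, so the scaling factor in `x - y` has exponent
zero and the value does not depend on the endpoints. -/
theorem integral_rpow_mul_rpow {σ y x : ℝ} (h0 : 0 < σ) (h1 : σ < 1) (hyx : y < x) :
    ∫ s in y..x, (x - s) ^ (σ - 1) * (s - y) ^ (-σ) = Real.Gamma σ * Real.Gamma (1 - σ) := by
  have hpos : 0 < x - y := sub_pos.2 hyx
  have key := Complex.betaIntegral_scaled ((1 - σ : ℝ) : ℂ) (σ : ℂ) hpos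
  have hG := Complex.Gamma_mul_Gamma_eq_betaIntegral (s := ((1 - σ : ℝ) : ℂ)) (t := (σ : ℂ))
    (by simpa using h1) (by simpa using h0)
  have hs : ((1 - σ : ℝ) : ℂ) + σ = 1 := by push_cast; ring
  rw [hs, Complex.Gamma_one, one_mul, Complex.Gamma_ofReal, Complex.Gamma_ofReal] at hG
  rw [hs, sub_self, Complex.cpow_zero, one_mul, ← hG] at key
  have h2 : ∫ t in (0 : ℝ)..(x - y), ((t ^ (-σ) * (x - y - t) ^ (σ - 1) : ℝ) : ℂ) =
      ((Real.Gamma (1 - σ) * Real.Gamma σ : ℝ) : ℂ) := by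
    rw [Complex.ofReal_mul, ← key]
    refine intervalIntegral.integral_congr fun t ht => ?_
    rw [uIcc_of_le hpos.le] at ht
    simp only [Complex.ofReal_mul]
    rw [Complex.ofReal_cpow ht.1, Complex.ofReal_cpow (sub_nonneg.2 ht.2)]
    push_cast
    ring_nf
  rw [intervalIntegral.integral_ofReal] at h2
  have h3 := Complex.ofReal_injective h2
  rw [mul_comm, ← h3, ← sub_self y,
    ← intervalIntegral.integral_comp_sub_right
      (fun t => t ^ (-σ) * (x - y - t) ^ (σ - 1)) y]
  refine intervalIntegral.integral_congr fun s _ => ?_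
  rw [mul_comm, sub_sub_sub_cancel_right]

/-- A non-integrable function has integral `0` by convention, whereas this integral is a positive
number. -/
theorem intervalIntegrable_rpow_mul_rpow {σ y x : ℝ} (h0 : 0 < σ) (h1 : σ < 1) (hyx : y < x) :
    IntervalIntegrable (fun s => (x - s) ^ (σ - 1) * (s - y) ^ (-σ)) volume y x := by
  refine intervalIntegral.intervalIntegrable_of_integral_ne_zero ?_
  rw [integral_rpow_mul_rpow h0 h1 hyx]
  exact (mul_pos (Real.Gamma_pos_of_pos h0) (Real.Gamma_pos_of_pos (by linarith))).ne'

theorem leftFracIntegral_leftKernel {a x α : ℝ} (h0 : 0 < α) (h1 : α < 1) (hx : a < x) :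
    leftFracIntegral a (1 - α) (leftKernel a α) x = Real.Gamma α := by
  have h := integral_rpow_mul_rpow (σ := 1 - α) (by linarith) (by linarith) hx
  have : ∫ y in a..x, leftKernel a α y / (x - y) ^ (1 - (1 - α)) =
      ∫ s in a..x, (x - s) ^ (1 - α - 1) * (s - a) ^ (-(1 - α)) := by
    refine intervalIntegral.integral_congr fun s hs => ?_
    rw [uIcc_of_le hx.le] at hs
    simp only [leftKernel]
    rw [div_eq_mul_inv, ← Real.rpow_neg (sub_nonneg.2 hs.2), mul_comm]
    ring_nf
  have hG := (Real.Gamma_pos_of_pos (show 0 < 1 - α by linarith)).ne'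
  rw [leftFracIntegral, this, h, sub_sub_cancel]
  field_simp

theorem integrable_rlKernel_mul_rlKernel {a b x y σ : ℝ} (h0 : 0 < σ) (h1 : σ < 1)
    (hx : x ∈ Ioo a b) (hy : y ∈ Ioo a x) :
    Integrable (fun s => rlKernel (b - a) (1 - σ) (s - y) * rlKernel (b - a) σ (x - s)) ∧
    ∫ s, rlKernel (b - a) (1 - σ) (s - y) * rlKernel (b - a) σ (x - s) =
      Real.Gamma σ * Real.Gamma (1 - σ) := by
  have e : (fun s => rlKernel (b - a) (1 - σ) (s - y) * rlKernel (b - a) σ (x - s)) =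
      (Ioo y x).indicator fun s => (x - s) ^ (σ - 1) * (s - y) ^ (-σ) := by
    funext s
    by_cases hs : s ∈ Ioo y x
    · rw [indicator_of_mem hs, rlKernel_of_mem _ ⟨sub_pos.2 hs.1, by linarith [hs.2, hy.1, hx.2]⟩,
        rlKernel_of_mem _ ⟨sub_pos.2 hs.2, by linarith [hs.1, hy.1, hx.2]⟩, mul_comm]
      ring_nf
    · rw [indicator_of_notMem hs]
      by_cases hys : y < s
      · rw [rlKernel_of_nonpos _ _ (sub_nonpos.2 (not_lt.1 fun h => hs ⟨hys, h⟩)), mul_zero]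
      · rw [rlKernel_of_nonpos _ _ (sub_nonpos.2 (not_lt.1 hys)), zero_mul]
  rw [e, integral_indicator measurableSet_Ioo, integrable_indicator_iff measurableSet_Ioo,
    ← integral_Ioc_eq_integral_Ioo, ← intervalIntegral.integral_of_le hy.2.le,
    integral_rpow_mul_rpow h0 h1 hy.2]
  exact ⟨(intervalIntegrable_iff_integrableOn_Ioo_of_le hy.2.le).1
    (intervalIntegrable_rpow_mul_rpow h0 h1 hy.2), rfl⟩

/-- Complementary fractional integrals compose to the ordinary integral. -/
theorem leftFracIntegral_leftFracIntegral {a b x σ : ℝ} (h0 : 0 < σ) (h1 : σ < 1)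
    (hx : x ∈ Ioo a b) {f : ℝ → ℝ} (hf : IntegrableOn f (Ioo a b)) :
    leftFracIntegral a σ (leftFracIntegral a (1 - σ) f) x = ∫ y in a..x, f y := by
  set k := rlKernel (b - a) σ with hk
  set l := rlKernel (b - a) (1 - σ) with hl
  have hfx : IntegrableOn f (Ioo a x) := hf.mono_set (Ioo_subset_Ioo_right hx.2.le)
  set g := (Ioo a x).indicator f with hg
  have hgi : Integrable g := hfx.integrable_indicator measurableSet_Ioo
  -- The upper limit `s` of the inner integral is carried by the kernel `l (s - y)`, so `f` may be
  -- cut off at the fixed point `x`, giving a double integral over the plane.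
  have inner : ∀ s, ((Ioo a b).indicator (leftFracIntegral a (1 - σ) f) s) * k (x - s) =
      1 / Real.Gamma (1 - σ) * ∫ y, g y * (l (s - y) * k (x - s)) := by
    intro s
    by_cases hs : s ∈ Ioo a x
    · have hsb : s ∈ Ioo a b := ⟨hs.1, hs.2.trans hx.2⟩
      rw [indicator_of_mem hsb, leftFracIntegral_eq_integral_rlKernel hsb, mul_assoc,
        ← integral_mul_const]
      congr 1
      refine integral_congr_ae (.of_forall fun y => ?_)
      simp only
      rw [← mul_assoc]
      congr 1
      by_cases hy : y < s
      · congr 1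
        by_cases hya : a < y
        · rw [hg, indicator_of_mem (show y ∈ Ioo a b from ⟨hya, hy.trans hsb.2⟩),
            indicator_of_mem (show y ∈ Ioo a x from ⟨hya, hy.trans hs.2⟩)]
        · rw [hg, indicator_of_notMem (fun h => hya h.1), indicator_of_notMem (fun h => hya h.1)]
      · rw [hl, rlKernel_of_nonpos _ _ (sub_nonpos.2 (not_lt.1 hy)), mul_zero, mul_zero]
    · by_cases hsa : a < s
      · have : k (x - s) = 0 :=
          rlKernel_of_nonpos _ _ (sub_nonpos.2 (not_lt.1 fun h => hs ⟨hsa, h⟩))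
        simp [this]
      · rw [indicator_of_notMem (fun h => hsa h.1), zero_mul]
        have : ∀ y, g y * (l (s - y) * k (x - s)) = 0 := by
          intro y
          by_cases hya : a < y
          · rw [hl, rlKernel_of_nonpos _ _ (by linarith [not_lt.1 hsa]), zero_mul, mul_zero]
          · rw [hg, indicator_of_notMem (fun h => hya h.1), zero_mul]
        simp [this]
  have cross : ∀ y, Integrable (fun s => g y * (l (s - y) * k (x - s))) ∧
      ∫ s, g y * (l (s - y) * k (x - s)) = g y * (Real.Gamma σ * Real.Gamma (1 - σ)) := by
    intro y
    by_cases hy : y ∈ Ioo a x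
    · obtain ⟨hi, he⟩ := integrable_rlKernel_mul_rlKernel h0 h1 hx hy
      exact ⟨hi.const_mul _, by rw [integral_const_mul, he]⟩
    · have : g y = 0 := indicator_of_notMem hy _
      simp [this]
  have hmeas : AEStronglyMeasurable (fun q : ℝ × ℝ => g q.2 * (l (q.1 - q.2) * k (x - q.1)))
      (volume.prod volume) := by
    refine hgi.aestronglyMeasurable.comp_snd.mul (Measurable.aestronglyMeasurable ?_)
    exact ((measurable_rlKernel _ _).comp (measurable_fst.sub measurable_snd)).mul
      ((measurable_rlKernel _ _).comp (measurable_const.sub measurable_fst))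
  have hint : Integrable (fun q : ℝ × ℝ => g q.2 * (l (q.1 - q.2) * k (x - q.1)))
      (volume.prod volume) := by
    -- Tonelli, integrating in `s` first: the kernels are nonnegative, so the norm integrates to `‖g
    -- y‖` times the Beta constant.
    rw [integrable_prod_iff' hmeas]
    refine ⟨.of_forall fun y => (cross y).1, ?_⟩
    have : (fun y => ∫ s, ‖g y * (l (s - y) * k (x - s))‖) =
        fun y => ‖g y‖ * (Real.Gamma σ * Real.Gamma (1 - σ)) := by
      funext y
      have hn : ∀ s, ‖g y * (l (s - y) * k (x - s))‖ = ‖g y‖ * (l (s - y) * k (x - s)) :=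
        fun s => by
          rw [norm_mul, Real.norm_of_nonneg
            (mul_nonneg (rlKernel_nonneg _ _ _) (rlKernel_nonneg _ _ _))]
      simp_rw [hn, integral_const_mul]
      by_cases hy : y ∈ Ioo a x
      · rw [(integrable_rlKernel_mul_rlKernel h0 h1 hx hy).2]
      · have : g y = 0 := indicator_of_notMem hy _
        simp [this]
    simpa only [this] using hgi.norm.mul_const _
  have hG0 := (Real.Gamma_pos_of_pos h0).ne'
  have hG1 := (Real.Gamma_pos_of_pos (show 0 < 1 - σ by linarith)).ne'
  rw [leftFracIntegral_eq_integral_rlKernel hx]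
  simp_rw [← hk, inner]
  rw [integral_const_mul, integral_integral_swap hint]
  simp_rw [(cross _).2]
  rw [integral_mul_const, hg, integral_indicator measurableSet_Ioo,
    intervalIntegral.integral_of_le hx.1.le, integral_Ioc_eq_integral_Ioo]
  field_simp

/-! ### Test functions and the du Bois-Reymond lemma -/

theorem IsTestFun.eq_zero {a b x : ℝ} {φ : ℝ → ℝ} (h : IsTestFun a b φ) (hx : x ∉ Ioo a b) :
    φ x = 0 := by
  by_contra h0
  exact hx (h.supp (subset_tsupport _ h0))

theorem IsTestFun.indicator_eq {a b : ℝ} {φ : ℝ → ℝ} (h : IsTestFun a b φ) :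
    (Ioo a b).indicator φ = φ := by
  funext x
  by_cases hx : x ∈ Ioo a b
  · exact indicator_of_mem hx _
  · rw [indicator_of_notMem hx, h.eq_zero hx]

theorem IsTestFun.deriv {a b : ℝ} {φ : ℝ → ℝ} (h : IsTestFun a b φ) :
    IsTestFun a b (deriv φ) where
  smooth := (contDiff_infty_iff_deriv.1 h.smooth).2
  compact := h.compact.deriv
  supp := (closure_minimal (support_deriv_subset) (isClosed_tsupport φ)).trans h.supp

theorem IsTestFun.integrableOn_mul {a b : ℝ} {φ f : ℝ → ℝ} (h : IsTestFun a b φ)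
    (hf : IntegrableOn f (Ioo a b)) : IntegrableOn (fun x => f x * φ x) (Ioo a b) := by
  obtain ⟨C, hC⟩ := h.compact.exists_bound_of_continuous h.smooth.continuous
  exact hf.mul_bdd h.smooth.continuous.aestronglyMeasurable (.of_forall hC)

theorem exists_Icc_of_isCompact_subset_Ioo {a b : ℝ} (hab : a < b) {K : Set ℝ} (hK : IsCompact K)
    (h : K ⊆ Ioo a b) : ∃ c d, a < c ∧ d < b ∧ K ⊆ Icc c d := by
  rcases K.eq_empty_or_nonempty with rfl | hne
  -- With `c = b` and `d = a` the interval `Icc c d` is empty.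
  · exact ⟨b, a, hab, hab, empty_subset _⟩
  · obtain ⟨c, hc⟩ := hK.exists_isLeast hne
    obtain ⟨d, hd⟩ := hK.exists_isGreatest hne
    exact ⟨c, d, (h hc.1).1, (h hd.1).2, fun x hx => ⟨hc.2 hx, hd.2 hx⟩⟩

/-- The primitive from `a` vanishes to the left of the support of `ψ` trivially, and to the right of
it because the total integral is zero. -/
theorem IsTestFun.exists_deriv_eq {a b : ℝ} (hab : a < b) {ψ : ℝ → ℝ} (h : IsTestFun a b ψ)
    (h0 : ∫ x, ψ x = 0) : ∃ φ, IsTestFun a b φ ∧ _root_.deriv φ = ψ := by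
  obtain ⟨c, d, hc, hd, hK⟩ := exists_Icc_of_isCompact_subset_Ioo hab h.compact h.supp
  have hcont := h.smooth.continuous
  have hD : ∀ x, HasDerivAt (fun x => ∫ t in a..x, ψ t) (ψ x) x := fun x =>
    (hcont.integral_hasStrictDerivAt a x).hasDerivAt
  have hzero : ∀ x, x ∉ Icc c d → ∫ t in a..x, ψ t = 0 := by
    intro x hx
    by_cases hcx : c ≤ x
    · have hdx : d < x := not_le.1 fun h => hx ⟨hcx, h⟩
      rw [intervalIntegral.integral_eq_integral_of_support_subset, h0]
      intro t ht
      have := hK (subset_tsupport _ ht)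
      exact ⟨hc.trans_le this.1, this.2.trans hdx.le⟩
    · rw [← intervalIntegral.integral_zero (a := a) (b := x) (μ := volume) (E := ℝ)]
      refine intervalIntegral.integral_congr fun t ht => ?_
      by_contra hne
      have h1 := hK (subset_tsupport _ hne)
      rcases mem_uIcc.1 ht with h2 | h2 <;> linarith [h1.1]
  have hsupp : Function.support (fun x => ∫ t in a..x, ψ t) ⊆ Icc c d := fun x hx => by
    by_contra hn
    exact hx (hzero x hn)
  refine ⟨fun x => ∫ t in a..x, ψ t, ⟨?_, HasCompactSupport.intro isCompact_Icc hzero, ?_⟩,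
    funext fun x => (hD x).deriv⟩
  · rw [contDiff_infty_iff_deriv, funext fun x => (hD x).deriv]
    exact ⟨fun x => (hD x).differentiableAt, h.smooth⟩
  · exact (closure_minimal hsupp isClosed_Icc).trans fun x hx => ⟨hc.trans_le hx.1, hx.2.trans_lt hd⟩

theorem exists_isTestFun_integral_eq_one {a b : ℝ} (hab : a < b) :
    ∃ η, IsTestFun a b η ∧ ∫ x, η x = 1 := by
  let B : ContDiffBump ((a + b) / 2) := ⟨(b - a) / 8, (b - a) / 4, by linarith, by linarith⟩
  refine ⟨B.normed volume, ⟨B.contDiff_normed, B.hasCompactSupport_normed, ?_⟩,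
    B.integral_normed⟩
  rw [B.tsupport_normed_eq, Real.closedBall_eq_Icc]
  have : B.rOut = (b - a) / 4 := rfl
  intro x hx
  rw [this] at hx
  exact ⟨by linarith [hx.1], by linarith [hx.2]⟩

theorem setIntegral_eq_integral_of_isTestFun {a b : ℝ} {φ : ℝ → ℝ} (h : IsTestFun a b φ)
    (f : ℝ → ℝ) : ∫ x in Ioo a b, f x * φ x = ∫ x, f x * φ x :=
  setIntegral_eq_integral_of_forall_compl_eq_zero fun x hx => by rw [h.eq_zero hx, mul_zero]

/-- The du Bois-Reymond lemma. -/
theorem exists_ae_eq_const_of_integral_mul_deriv_eq_zero {a b : ℝ} (hab : a < b) {H : ℝ → ℝ}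
    (hH : IntegrableOn H (Ioo a b))
    (h : ∀ φ, IsTestFun a b φ → ∫ x in Ioo a b, H x * deriv φ x = 0) :
    ∃ c, ∀ᵐ x ∂(volume.restrict (Ioo a b)), H x = c := by
  obtain ⟨η, hη, hη1⟩ := exists_isTestFun_integral_eq_one hab
  refine ⟨∫ x in Ioo a b, H x * η x, ?_⟩
  set c := ∫ x in Ioo a b, H x * η x with hc
  have hconst : IntegrableOn (fun _ : ℝ => c) (Ioo a b) := by simp
  have hi : IntegrableOn (fun x => H x - c) (Ioo a b) := hH.sub hconst
  rw [ae_restrict_iff' measurableSet_Ioo]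
  refine (isOpen_Ioo.ae_eq_zero_of_integral_contDiff_smul_eq_zero
    hi.locallyIntegrableOn ?_).mono fun x hx hxm => sub_eq_zero.1 (hx hxm)
  intro g g1 g2 g3
  have hg : IsTestFun a b g := ⟨g1, g2, g3⟩
  have hgi : Integrable g := g1.continuous.integrable_of_hasCompactSupport g2
  have hηi : Integrable η := hη.smooth.continuous.integrable_of_hasCompactSupport hη.compact
  -- Subtracting the mass of `g` times `η` leaves integral zero, so the result is the derivative of
  -- a test function. The correction term is what produces `c = ∫ H η`.
  have hψ : IsTestFun a b (fun x => g x - (∫ t, g t) * η x) := by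
    refine ⟨g1.sub (contDiff_const.mul hη.smooth), g2.sub hη.compact.mul_left, ?_⟩
    refine (tsupport_sub _ _).trans (union_subset g3 ?_)
    exact (tsupport_mul_subset_right (f := fun _ => ∫ t, g t)).trans hη.supp
  obtain ⟨φ, hφ, hφd⟩ := hψ.exists_deriv_eq hab (by
    rw [integral_sub hgi (hηi.const_mul _), integral_const_mul, hη1, mul_one, sub_self])
  have h2 := h φ hφ
  rw [hφd] at h2
  have e1 : (fun x => H x * (g x - (∫ t, g t) * η x)) =
      fun x => H x * g x - (∫ t, g t) * (H x * η x) := by funext x; ring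
  rw [e1, integral_sub (hg.integrableOn_mul hH) ((hη.integrableOn_mul hH).const_mul _),
    integral_const_mul, ← hc] at h2
  have e2 : (fun x => g x • (H x - c)) = fun x => (H x - c) * g x := by
    funext x; rw [smul_eq_mul, mul_comm]
  rw [e2, ← setIntegral_eq_integral_of_isTestFun hg]
  simp_rw [sub_mul]
  rw [integral_sub (hg.integrableOn_mul hH) (hg.integrableOn_mul hconst), integral_const_mul,
    setIntegral_eq_integral_of_forall_compl_eq_zero (fun x hx => hg.eq_zero hx)]
  linarith

/-- Integration by parts for absolutely continuous functions; `φ` is Lipschitz and vanishes at both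
endpoints. -/
theorem integral_integral_mul_deriv_eq_neg {a b : ℝ} (hab : a < b) {v φ : ℝ → ℝ}
    (hv : IntegrableOn v (Ioo a b)) (hφ : IsTestFun a b φ) :
    ∫ x in Ioo a b, (∫ t in a..x, v t) * deriv φ x = -∫ x in Ioo a b, v x * φ x := by
  have hvi : IntervalIntegrable v volume a b :=
    (intervalIntegrable_iff_integrableOn_Ioo_of_le hab.le).2 hv
  have hV := hvi.absolutelyContinuousOnInterval_intervalIntegral (c := a) left_mem_uIcc
  have hφac : AbsolutelyContinuousOnInterval φ a b := by
    obtain ⟨C, hC⟩ := hφ.deriv.compact.exists_bound_of_continuous hφ.deriv.smooth.continuous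
    have : LipschitzWith (Real.toNNReal C) φ := by
      refine lipschitzWith_of_nnnorm_deriv_le (hφ.smooth.differentiable (by simp)) fun x => ?_
      rw [← NNReal.coe_le_coe, coe_nnnorm]
      exact (hC x).trans (Real.le_coe_toNNReal C)
    exact this.lipschitzOnWith.absolutelyContinuousOnInterval
  have key := hV.integral_mul_deriv_eq_deriv_mul hφac
  rw [hφ.eq_zero (x := a) (by simp), hφ.eq_zero (x := b) (by simp)] at key
  rw [← integral_Ioc_eq_integral_Ioo, ← integral_Ioc_eq_integral_Ioo,
    ← intervalIntegral.integral_of_le hab.le, ← intervalIntegral.integral_of_le hab.le, key,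
    mul_zero, mul_zero, sub_self, zero_sub, neg_inj]
  refine intervalIntegral.integral_congr_ae ?_
  filter_upwards [hvi.ae_hasDerivAt_integral] with x hx hxm
  rw [(hx (uIoc_subset_uIcc hxm) a left_mem_uIcc).deriv]

theorem exists_ae_eq_const_add_integral {a b : ℝ} (hab : a < b) {G v : ℝ → ℝ}
    (hG : IntegrableOn G (Ioo a b)) (hv : IntegrableOn v (Ioo a b))
    (h : ∀ φ, IsTestFun a b φ →
      ∫ x in Ioo a b, v x * φ x = -∫ x in Ioo a b, G x * deriv φ x) :
    ∃ c, ∀ᵐ x ∂(volume.restrict (Ioo a b)), G x = c + ∫ t in a..x, v t := by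
  have hV : IntegrableOn (fun x => ∫ t in a..x, v t) (Ioo a b) := by
    have hvi : IntervalIntegrable v volume a b :=
      (intervalIntegrable_iff_integrableOn_Ioo_of_le hab.le).2 hv
    have := (hvi.absolutelyContinuousOnInterval_intervalIntegral
      (c := a) left_mem_uIcc).continuousOn.integrableOn_compact isCompact_uIcc (μ := volume)
    rw [uIcc_of_le hab.le] at this
    exact this.mono_set Ioo_subset_Icc_self
  obtain ⟨c, hc⟩ := exists_ae_eq_const_of_integral_mul_deriv_eq_zero hab (hG.sub hV)
    (fun φ hφ => by
      simp only [Pi.sub_apply, sub_mul]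
      rw [integral_sub (hφ.deriv.integrableOn_mul hG) (hφ.deriv.integrableOn_mul hV),
        integral_integral_mul_deriv_eq_neg hab hv hφ, h φ hφ]
      ring)
  exact ⟨c, hc.mono fun x hx => by simp only [Pi.sub_apply] at hx; linarith⟩

/-! ### Moving the fractional operators onto the test function -/

/-- Fractional integration by parts. -/
theorem integral_leftFracIntegral_mul {a b σ : ℝ} (hσ : 0 < σ) {u φ : ℝ → ℝ}
    (hu : IntegrableOn u (Ioo a b)) (hφ : IsTestFun a b φ) :
    ∫ x in Ioo a b, leftFracIntegral a σ u x * φ x =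
      ∫ x in Ioo a b, u x * rightFracIntegral b σ φ x := by
  obtain ⟨C, hC⟩ := hφ.compact.exists_bound_of_continuous hφ.smooth.continuous
  have hint := (integrable_indicator_mul_rlKernel hσ hu).mul_bdd (g := fun q : ℝ × ℝ => φ q.1)
    (hφ.smooth.continuous.comp continuous_fst).aestronglyMeasurable (.of_forall fun q => hC q.1)
  have hL : ∫ x in Ioo a b, leftFracIntegral a σ u x * φ x = 1 / Real.Gamma σ *
      ∫ x, ∫ y, (Ioo a b).indicator u y * rlKernel (b - a) σ (x - y) * φ x := by
    symm
    rw [← integral_const_mul, ← setIntegral_eq_integral_of_forall_compl_eq_zero (s := Ioo a b)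
      fun x hx => by simp [hφ.eq_zero hx]]
    refine setIntegral_congr_fun measurableSet_Ioo fun x hx => ?_
    rw [leftFracIntegral_eq_integral_rlKernel hx, integral_mul_const, mul_assoc]
  have hR : ∫ x in Ioo a b, u x * rightFracIntegral b σ φ x = 1 / Real.Gamma σ *
      ∫ y, ∫ x, (Ioo a b).indicator u y * rlKernel (b - a) σ (x - y) * φ x := by
    symm
    rw [← integral_const_mul, ← setIntegral_eq_integral_of_forall_compl_eq_zero (s := Ioo a b)
      fun x hx => by simp [indicator_of_notMem hx]]
    refine setIntegral_congr_fun measurableSet_Ioo fun x hx => ?_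
    rw [rightFracIntegral_eq_integral_rlKernel hx, hφ.indicator_eq, indicator_of_mem hx]
    simp_rw [mul_assoc]
    rw [integral_const_mul]
    simp_rw [mul_comm (φ _)]
    ring
  rw [hL, hR, integral_integral_swap hint]

/-- On `(a, b)` the right integral is the convolution of `φ` with the reflected kernel, and the
derivative may be put on the smooth factor. The formula holds only inside the interval, which is
enough for a derivative at `x`. -/
theorem rightFracDeriv_eq_neg_rightFracIntegral_deriv {a b α x : ℝ} (h1 : α < 1) {φ : ℝ → ℝ}
    (hφ : IsTestFun a b φ) (hx : x ∈ Ioo a b) :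
    rightFracDeriv b α φ x = -rightFracIntegral b (1 - α) (deriv φ) x := by
  have hk : Integrable (fun t => rlKernel (b - a) (1 - α) (-t)) :=
    (integrable_rlKernel (b - a) (show 0 < 1 - α by linarith)).comp_neg
  have repr : ∀ ψ, IsTestFun a b ψ → ∀ z ∈ Ioo a b, rightFracIntegral b (1 - α) ψ z =
      1 / Real.Gamma (1 - α) * convolution (fun t => rlKernel (b - a) (1 - α) (-t)) ψ
        (ContinuousLinearMap.mul ℝ ℝ) volume z := by
    intro ψ hψ z hz
    rw [rightFracIntegral_eq_integral_rlKernel hz, hψ.indicator_eq, convolution_eq_swap]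
    simp [mul_comm]
  have hD := (hφ.compact.hasDerivAt_convolution_right (ContinuousLinearMap.mul ℝ ℝ)
    hk.locallyIntegrable (hφ.smooth.of_le (by simp)) x).const_mul (1 / Real.Gamma (1 - α))
  rw [rightFracDeriv, repr _ hφ.deriv x hx, ← hD.deriv]
  congr 1
  refine Filter.EventuallyEq.deriv_eq ?_
  filter_upwards [isOpen_Ioo.mem_nhds hx] with z hz using repr φ hφ z hz

/-! ### Inverting the fractional integral -/

theorem ae_eq_zero_of_forall_intervalIntegral_eq_zero {a b : ℝ} {f : ℝ → ℝ}
    (hf : IntegrableOn f (Ioo a b)) (h : ∀ x ∈ Ioo a b, ∫ t in a..x, f t = 0) :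
    ∀ᵐ x ∂(volume.restrict (Ioo a b)), f x = 0 := by
  rcases le_or_gt b a with hab | hab
  · simp [Ioo_eq_empty_of_le hab]
  have hfi : IntervalIntegrable f volume a b :=
    (intervalIntegrable_iff_integrableOn_Ioo_of_le hab.le).2 hf
  rw [ae_restrict_iff' measurableSet_Ioo]
  filter_upwards [hfi.ae_hasDerivAt_integral] with x hx hxm
  have h1 := hx (Ioo_subset_Icc_self.trans Icc_subset_uIcc hxm) a left_mem_uIcc
  have h2 : (fun x => ∫ t in a..x, f t) =ᶠ[nhds x] fun _ => 0 := by
    filter_upwards [isOpen_Ioo.mem_nhds hxm] with z hz using h z hz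
  exact h1.unique ((hasDerivAt_const x (0 : ℝ)).congr_of_eventuallyEq h2)

theorem integrableOn_leftKernel {a α : ℝ} (h0 : 0 < α) (b : ℝ) :
    IntegrableOn (leftKernel a α) (Ioo a b) := by
  rcases le_or_gt b a with hab | hab
  · simp [Ioo_eq_empty_of_le hab]
  rw [← intervalIntegrable_iff_integrableOn_Ioo_of_le hab.le]
  change IntervalIntegrable (fun x => (x - a) ^ (α - 1)) volume a b
  simpa using (intervalIntegral.intervalIntegrable_rpow' (a := 0) (b := b - a)
    (show -1 < α - 1 by linarith)).comp_sub_right a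

/-- A function on `(a, b)` is determined by its fractional integral of order `1 - α`. -/
theorem ae_eq_zero_of_leftFracIntegral_ae_eq_zero {a b α : ℝ} (h0 : 0 < α) (h1 : α < 1)
    {f : ℝ → ℝ} (hf : IntegrableOn f (Ioo a b))
    (h : leftFracIntegral a (1 - α) f =ᵐ[volume.restrict (Ioo a b)] fun _ => 0) :
    ∀ᵐ x ∂(volume.restrict (Ioo a b)), f x = 0 := by
  refine ae_eq_zero_of_forall_intervalIntegral_eq_zero hf fun x hx => ?_
  -- Applying the integral of order `α` to that of order `1 - α` recovers the primitive of `f`.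
  rw [← leftFracIntegral_leftFracIntegral h0 h1 hx hf, leftFracIntegral_congr_ae hx α h]
  simp [leftFracIntegral]

theorem ae_eq_of_leftFracIntegral_ae_eq {a b α c : ℝ} (h0 : 0 < α) (h1 : α < 1)
    {u v : ℝ → ℝ} (hu : IntegrableOn u (Ioo a b)) (hv : IntegrableOn v (Ioo a b))
    (h : ∀ᵐ x ∂(volume.restrict (Ioo a b)),
      leftFracIntegral a (1 - α) u x = c + ∫ t in a..x, v t) :
    ∀ᵐ x ∂(volume.restrict (Ioo a b)),
      u x = c / Real.Gamma α * leftKernel a α x + leftFracIntegral a α v x := by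
  have hσ : 0 < 1 - α := by linarith
  have hk : IntegrableOn (fun x => c / Real.Gamma α * leftKernel a α x) (Ioo a b) :=
    (integrableOn_leftKernel h0 b).const_mul _
  have hI := integrableOn_leftFracIntegral h0 hv
  suffices H : ∀ᵐ x ∂(volume.restrict (Ioo a b)),
      u x - c / Real.Gamma α * leftKernel a α x - leftFracIntegral a α v x = 0 from
    H.mono fun x hx => by linarith
  refine ae_eq_zero_of_leftFracIntegral_ae_eq_zero h0 h1 ((hu.sub hk).sub hI) ?_
  filter_upwards [h, ae_intervalIntegrable_leftFracIntegral hσ hu,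
    ae_intervalIntegrable_leftFracIntegral hσ hk, ae_intervalIntegrable_leftFracIntegral hσ hI,
    ae_restrict_mem measurableSet_Ioo] with x hx i1 i2 i3 hxm
  have e1 := leftFracIntegral_leftKernel h0 h1 hxm.1
  have e2 := leftFracIntegral_leftFracIntegral hσ (by linarith) hxm hv
  rw [sub_sub_cancel] at e2
  have e3 : leftFracIntegral a (1 - α) (fun x => c / Real.Gamma α * leftKernel a α x) x = c := by
    simp only [leftFracIntegral, mul_div_assoc, intervalIntegral.integral_const_mul]
    rw [mul_left_comm, ← leftFracIntegral.eq_1, e1,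
      div_mul_cancel₀ _ (Real.Gamma_pos_of_pos h0).ne']
  rw [leftFracIntegral] at hx e2 e3 ⊢
  simp only [sub_div]
  rw [intervalIntegral.integral_sub (i1.sub i2) i3, intervalIntegral.integral_sub i1 i2, mul_sub,
    mul_sub, hx, e2, e3]
  ring

/-! ### The left representation formula -/

theorem IsLeftWeakFracDeriv.exists_const {a b α : ℝ} (hab : a < b) (h0 : 0 < α) (h1 : α < 1)
    {u v : ℝ → ℝ} (h : IsLeftWeakFracDeriv a b α u v) (hv : IntegrableOn v (Ioo a b)) :
    ∃ c, (∀ᵐ x ∂(volume.restrict (Ioo a b)),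
        leftFracIntegral a (1 - α) u x = c + ∫ t in a..x, v t) ∧
      ∀ᵐ x ∂(volume.restrict (Ioo a b)),
        u x = c / Real.Gamma α * leftKernel a α x + leftFracIntegral a α v x := by
  have hσ : 0 < 1 - α := by linarith
  obtain ⟨c, hc⟩ := exists_ae_eq_const_add_integral hab
    (integrableOn_leftFracIntegral hσ h.integrable) hv fun φ hφ => by
      rw [h.integral_eq φ hφ, integral_leftFracIntegral_mul hσ h.integrable hφ.deriv,
        ← integral_neg]
      refine setIntegral_congr_fun measurableSet_Ioo fun x hx => ?_
      rw [rightFracDeriv_eq_neg_rightFracIntegral_deriv h1 hφ hx, mul_neg]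
  exact ⟨c, hc, ae_eq_of_leftFracIntegral_ae_eq h0 h1 h.integrable hv hc⟩

/-- The base point `d` and factor `e` serve both sides: `a` and `1` on the left, `b` and `-1` on the
right. -/
theorem IsACRepresentative.const_add_integral {a b c d e : ℝ} (hd : d ∈ uIcc a b) {f g : ℝ → ℝ}
    (hf : IntervalIntegrable f volume a b)
    (h : ∀ᵐ x ∂(volume.restrict (Ioo a b)), g x = c + e * ∫ t in d..x, f t) :
    IsACRepresentative a b g fun x => c + e * ∫ t in d..x, f t where
  absolutelyContinuous :=
    contDiff_const.contDiffOn.absolutelyContinuousOnInterval.add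
      ((hf.absolutelyContinuousOnInterval_intervalIntegral hd).const_mul e)
  ae_eq := h.mono fun _ hx => hx.symm

/-! ### Reflection and the right representation formula -/

theorem rightFracIntegral_comp_reflect (a b σ : ℝ) (f : ℝ → ℝ) (x : ℝ) :
    rightFracIntegral b σ (fun y => f (a + b - y)) x = leftFracIntegral a σ f (a + b - x) := by
  rw [leftFracIntegral, rightFracIntegral]
  congr 1
  have := intervalIntegral.integral_comp_sub_left (a := x) (b := b)
    (fun y => f y / (a + b - x - y) ^ (1 - σ)) (a + b)
  rw [add_sub_cancel_right] at this
  rw [← this]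
  refine intervalIntegral.integral_congr fun y _ => ?_
  rw [sub_sub_sub_cancel_left]

theorem leftFracIntegral_comp_reflect (a b σ : ℝ) (f : ℝ → ℝ) (x : ℝ) :
    leftFracIntegral a σ (fun y => f (a + b - y)) x = rightFracIntegral b σ f (a + b - x) := by
  have := rightFracIntegral_comp_reflect a b σ (fun y => f (a + b - y)) (a + b - x)
  simp only [sub_sub_cancel] at this
  exact this.symm

/-- The sign from the chain rule cancels the sign in the right derivative. -/
theorem rightFracDeriv_comp_reflect (a b α : ℝ) (f : ℝ → ℝ) (x : ℝ) :
    rightFracDeriv b α (fun y => f (a + b - y)) x = leftFracDeriv a α f (a + b - x) := by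
  rw [rightFracDeriv, leftFracDeriv, funext (rightFracIntegral_comp_reflect a b (1 - α) f),
    deriv_comp_const_sub, neg_neg]

theorem preimage_reflect_Ioo (a b : ℝ) : (fun x => a + b - x) ⁻¹' Ioo a b = Ioo a b := by
  rw [preimage_const_sub_Ioo, add_sub_cancel_right, add_sub_cancel_left]

theorem measurePreserving_reflect (a b : ℝ) :
    MeasurePreserving (fun x : ℝ => a + b - x) (volume.restrict (Ioo a b))
      (volume.restrict (Ioo a b)) := by
  have := (Measure.measurePreserving_sub_left volume (a + b)).restrict_preimage
    (measurableSet_Ioo (a := a) (b := b))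
  rwa [preimage_reflect_Ioo] at this

theorem measurableEmbedding_reflect (a b : ℝ) : MeasurableEmbedding fun x : ℝ => a + b - x :=
  (Homeomorph.subLeft (a + b)).measurableEmbedding

theorem IsTestFun.comp_reflect {a b : ℝ} {φ : ℝ → ℝ} (h : IsTestFun a b φ) :
    IsTestFun a b fun x => φ (a + b - x) where
  smooth := h.smooth.comp (contDiff_const.sub contDiff_id)
  compact := h.compact.comp_homeomorph (Homeomorph.subLeft (a + b))
  supp := by
    refine (tsupport_comp_subset_preimage φ (by fun_prop)).trans ?_
    exact (preimage_mono h.supp).trans (preimage_reflect_Ioo a b).subset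

theorem IntegrableOn.comp_reflect {a b : ℝ} {f : ℝ → ℝ} (h : IntegrableOn f (Ioo a b)) :
    IntegrableOn (fun x => f (a + b - x)) (Ioo a b) :=
  ((measurePreserving_reflect a b).integrable_comp_emb (measurableEmbedding_reflect a b)).2 h

theorem setIntegral_comp_reflect (a b : ℝ) (f : ℝ → ℝ) :
    ∫ x in Ioo a b, f (a + b - x) = ∫ x in Ioo a b, f x :=
  (measurePreserving_reflect a b).integral_comp (measurableEmbedding_reflect a b) f

theorem IsRightWeakFracDeriv.comp_reflect {a b α : ℝ} {u w : ℝ → ℝ}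
    (h : IsRightWeakFracDeriv a b α u w) (hw : IntegrableOn w (Ioo a b)) :
    IsLeftWeakFracDeriv a b α (fun x => u (a + b - x)) (fun x => w (a + b - x)) where
  integrable := IntegrableOn.comp_reflect h.integrable
  locallyIntegrable := (IntegrableOn.comp_reflect hw).locallyIntegrableOn
  integral_eq φ hφ := by
    have := h.integral_eq _ hφ.comp_reflect
    rw [← setIntegral_comp_reflect, ← setIntegral_comp_reflect a b (fun x => u x * _)] at this
    simp only [sub_sub_cancel] at this
    rw [this]
    refine integral_congr_ae (.of_forall fun x => ?_)
    simp only
    rw [← rightFracDeriv_comp_reflect]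
    simp only [sub_sub_cancel]

theorem IsRightWeakFracDeriv.exists_const {a b α : ℝ} (hab : a < b) (h0 : 0 < α) (h1 : α < 1)
    {u w : ℝ → ℝ} (h : IsRightWeakFracDeriv a b α u w) (hw : IntegrableOn w (Ioo a b)) :
    ∃ c, (∀ᵐ x ∂(volume.restrict (Ioo a b)),
        rightFracIntegral b (1 - α) u x = c + -1 * ∫ t in b..x, w t) ∧
      ∀ᵐ x ∂(volume.restrict (Ioo a b)),
        u x = c / Real.Gamma α * rightKernel b α x + rightFracIntegral b α w x := by
  obtain ⟨c, hc1, hc2⟩ := (h.comp_reflect hw).exists_const hab h0 h1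
    (IntegrableOn.comp_reflect hw)
  have hR := (measurePreserving_reflect a b).quasiMeasurePreserving
  refine ⟨c, (hR.ae hc1).mono fun x hx => ?_, (hR.ae hc2).mono fun x hx => ?_⟩
  -- The reflected primitive is `∫_x^b w`; basing it at `b` instead gives the factor `-1`.
  · rw [leftFracIntegral_comp_reflect, sub_sub_cancel, intervalIntegral.integral_comp_sub_left,
      sub_sub_cancel, add_sub_cancel_left, intervalIntegral.integral_symm] at hx
    rw [hx]
    ring
  · rw [leftFracIntegral_comp_reflect, sub_sub_cancel, leftKernel] at hx
    rw [hx, rightKernel, show a + b - x - a = b - x by ring]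

theorem mainTheorem1 (a b : ℝ) (hab : a < b) (α : ℝ) (hα0 : 0 < α) (hα1 : α < 1)
    (p : ENNReal) (hp1 : 1 ≤ p) (hp : p ≠ ⊤)
    (u : ℝ → ℝ) (hu : MemLp u p (volume.restrict (Ioo a b))) :
    (∀ v : ℝ → ℝ, IsLeftWeakFracDeriv a b α u v → MemLp v p (volume.restrict (Ioo a b)) →
      ∃ F : ℝ → ℝ, IsACRepresentative a b (leftFracIntegral a (1 - α) u) F ∧
        ∀ᵐ x ∂(volume.restrict (Ioo a b)),
          u x = F a / Real.Gamma α * leftKernel a α x + leftFracIntegral a α v x) ∧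
    (∀ w : ℝ → ℝ, IsRightWeakFracDeriv a b α u w → MemLp w p (volume.restrict (Ioo a b)) →
      ∃ F : ℝ → ℝ, IsACRepresentative a b (rightFracIntegral b (1 - α) u) F ∧
        ∀ᵐ x ∂(volume.restrict (Ioo a b)),
          u x = F b / Real.Gamma α * rightKernel b α x + rightFracIntegral b α w x) := by
  refine ⟨fun v hv hvp => ?_, fun w hw hwp => ?_⟩
  · have hvi : IntegrableOn v (Ioo a b) := hvp.integrable hp1
    obtain ⟨c, hc1, hc2⟩ := hv.exists_const hab hα0 hα1 hvi
    refine ⟨_, IsACRepresentative.const_add_integral (c := c) (e := 1) (left_mem_uIcc (a := a))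
      ((intervalIntegrable_iff_integrableOn_Ioo_of_le hab.le).2 hvi) ?_, ?_⟩
    · simpa only [one_mul] using hc1
    · simpa only [intervalIntegral.integral_same, mul_zero, add_zero] using hc2
  · have hwi : IntegrableOn w (Ioo a b) := hwp.integrable hp1
    obtain ⟨c, hc1, hc2⟩ := hw.exists_const hab hα0 hα1 hwi
    refine ⟨_, IsACRepresentative.const_add_integral (right_mem_uIcc (b := b))
      ((intervalIntegrable_iff_integrableOn_Ioo_of_le hab.le).2 hwi) hc1, ?_⟩
    simpa only [intervalIntegral.integral_same, mul_zero, add_zero] using hc2
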